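/- Consider turn-based two-player zero-sum discounted Markov games on the state space $[0,1]^d$, $d\ge 1$: the states are split into a measurable set $\mathcal S_1$ (controlled by player 1) and its complement $\mathcal S_2$ (controlled by player 2), both players use the same finite non-empty action set $\mathcal A$, transitions are deterministic, $s\mapsto s\circ a$ (measurable in $(s,a)$), rewards are bounded random variables whose law depends on the current state and action, and $V^*$ denotes the value function of the Nash equilibria in stationary policies. An algorithm is any randomized adaptive procedure that repeatedly chooses a state and an action (based on its internal randomness and on everything observed so far), observes the reward and the next state, and after $T$ such sampled transitions outputs an estimate $\hat V_T:[0,1]^d\to\mathbb R$ of $V^*$. There is a constant $C'>0$ such that for every $d\ge 1$ and every $\delta\in(0,1)$ there is $\varepsilon_0>0$ with the following property. Let $\mathcal A$, $\mathcal S_1$ and the transition map be given, let any algorithm be given, and let $0<\varepsilon<\varepsilon_0$. Then there is a two-player zero-sum Markov game with these data, with discount factor $\gamma=0$ and with Bernoulli rewards whose mean is a function of the state only that is $1$-Lipschitz for the Euclidean norm, such that its optimal value function $V^*$ exists and, for every $T$, $$\mathbb P\big[\|\hat V_T-V^*\|_\infty<\varepsilon\big]\ge 1-\delta \quad\Longrightarrow\quad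 T\ \ge\ C'\,d\,\varepsilon^{-(d+2)}\log(1/\varepsilon).$$ -/

import Mathlib

open MeasureTheory ProbabilityTheory
open scoped ENNReal

noncomputable section

namespace MarkovGame

/-- The unit cube `[0,1]^d` in the Euclidean space `ℝ^d`. -/
def cube (d : ℕ) : Set (EuclideanSpace ℝ (Fin d)) :=
  {x | ∀ i, x i ∈ Set.Icc (0 : ℝ) 1}

/-- A turn-based two-player zero-sum discounted Markov game with state space a compact set
`S ⊆ ℝ^d`, the same action set `A` for both players, and deterministic transitions. The states in
`S₁` are controlled by player 1, those in the complement of `S₁` by player 2. Rewards are random: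
`reward (s, a)` is the law of the reward that player 1 receives (and player 2 pays) when `a` is
played at `s`. -/
structure Game {d : ℕ} (S : Set (EuclideanSpace ℝ (Fin d))) (A : Type*) [MeasurableSpace A] where
  isCompact_states : IsCompact S
  S₁ : Set S
  measurableSet_S₁ : MeasurableSet S₁
  /-- the state `s ∘ a` reached after playing `a` at `s` -/
  step : S × A → S
  measurable_step : Measurable step
  reward : Kernel (S × A) ℝ
  markov_reward : IsMarkovKernel reward
  Rmax : ℝ
  Rmax_pos : 0 < Rmax
  reward_bounded : ∀ z, ∀ᵐ r ∂(reward z), r ∈ Set.Icc (-Rmax) Rmax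
  /-- the discount factor -/
  γ : ℝ
  γ_nonneg : 0 ≤ γ
  γ_lt_one : γ < 1

namespace Game

variable {d : ℕ} {S : Set (EuclideanSpace ℝ (Fin d))} {A : Type*} [MeasurableSpace A]

instance (g : Game S A) : IsMarkovKernel g.reward := g.markov_reward

/-- The states controlled by player 2. -/
def S₂ (g : Game S A) : Set S := g.S₁ᶜ

/-- Stationary policies of player 1: a probability distribution on `A` at each state of `S₁`. -/
def Policy₁ (g : Game S A) := {π : Kernel g.S₁ A // IsMarkovKernel π}

/-- Stationary policies of player 2: a probability distribution on `A` at each state of `S₂`. -/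
def Policy₂ (g : Game S A) := {π : Kernel g.S₂ A // IsMarkovKernel π}

open Classical in
/-- The rule by which the player to move at `s` picks an action. -/
def play (g : Game S A) (π₁ : g.Policy₁) (π₂ : g.Policy₂) : Kernel S A where
  toFun s := if h : s ∈ g.S₁ then π₁.1 ⟨s, h⟩ else π₂.1 ⟨s, h⟩
  measurable' := Measurable.dite π₁.1.measurable π₂.1.measurable g.measurableSet_S₁

instance (g : Game S A) (π₁ : g.Policy₁) (π₂ : g.Policy₂) : IsMarkovKernel (g.play π₁ π₂) := by
  have h₁ := π₁.2
  have h₂ := π₂.2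
  refine ⟨fun s => ?_⟩
  classical
  change IsProbabilityMeasure (if h : s ∈ g.S₁ then π₁.1 ⟨s, h⟩ else π₂.1 ⟨s, h⟩)
  split_ifs
  · exact h₁.isProbabilityMeasure _
  · exact h₂.isProbabilityMeasure _

/-- One round of play from state `s`: the triple (state, action, reward). -/
def round (g : Game S A) (π₁ : g.Policy₁) (π₂ : g.Policy₂) : Kernel S (S × A × ℝ) :=
  Kernel.id ×ₖ (g.play π₁ π₂ ⊗ₖ g.reward)

instance (g : Game S A) (π₁ : g.Policy₁) (π₂ : g.Policy₂) : IsMarkovKernel (g.round π₁ π₂) := by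
  unfold round; infer_instance

/-- The conditional law of round `n + 1` given the rounds `0, …, n`. -/
def nextRound (g : Game S A) (π₁ : g.Policy₁) (π₂ : g.Policy₂) (n : ℕ) :
    Kernel (∀ _ : Finset.Iic n, S × A × ℝ) (S × A × ℝ) :=
  (g.round π₁ π₂).comap
    (fun h => g.step ((h ⟨n, by simp⟩).1, (h ⟨n, by simp⟩).2.1))
    (g.measurable_step.comp (by fun_prop))

instance (g : Game S A) (π₁ : g.Policy₁) (π₂ : g.Policy₂) (n : ℕ) :
    IsMarkovKernel (g.nextRound π₁ π₂ n) := by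
  unfold nextRound; infer_instance

/-- The law of the infinite play (states, actions, rewards) that starts at `s`. -/
def playLaw (g : Game S A) (π₁ : g.Policy₁) (π₂ : g.Policy₂) (s : S) :
    Measure (ℕ → S × A × ℝ) :=
  Kernel.trajMeasure (X := fun _ => S × A × ℝ) (g.round π₁ π₂ s) (g.nextRound π₁ π₂)

/-- The value `V_{π₁,π₂}(s)`: the expected total discounted reward of player 1. -/
def value (g : Game S A) (π₁ : g.Policy₁) (π₂ : g.Policy₂) (s : S) : ℝ :=
  ∫ ω, ∑' k : ℕ, g.γ ^ k * (ω k).2.2 ∂(g.playLaw π₁ π₂ s)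

/-- `(π₁, π₂)` is an equilibrium: each policy is an optimal counter-policy against the other. -/
def IsEquilibrium (g : Game S A) (π₁ : g.Policy₁) (π₂ : g.Policy₂) : Prop :=
  (∀ π₁' : g.Policy₁, ∀ s, g.value π₁' π₂ s ≤ g.value π₁ π₂ s) ∧
    ∀ π₂' : g.Policy₂, ∀ s, g.value π₁ π₂ s ≤ g.value π₁ π₂' s

/-- `V` is the optimal value function `V*`: the game has an equilibrium, and `V` is the value
function of every equilibrium. -/
def IsOptimalValue (g : Game S A) (V : S → ℝ) : Prop :=
  (∃ π₁ π₂, g.IsEquilibrium π₁ π₂) ∧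
    ∀ π₁ π₂, g.IsEquilibrium π₁ π₂ → g.value π₁ π₂ = V

end Game

/-- What is observed in `t` transitions: state, action, reward and next state, for each of them. -/
abbrev History (X A : Type*) (t : ℕ) := Fin t → X × A × ℝ × X

/-- A (randomized, adaptive) learning algorithm for games with state space `X` and action set `A`.
Its internal randomness is a seed with an arbitrary law. From the seed and from what it has
observed so far, it picks the state and the action of the next sampled transition; after `T`
transitions it estimates the value function. -/
structure Algorithm (X A : Type*) [MeasurableSpace X] [MeasurableSpace A] where
  Seed : Type*
  measurableSpaceSeed : MeasurableSpace Seed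
  seedLaw : Measure Seed
  isProbabilityMeasure_seedLaw : IsProbabilityMeasure seedLaw
  query : (t : ℕ) → Seed × History X A t → X × A
  measurable_query : ∀ t, Measurable (query t)
  estimate : (T : ℕ) → Seed × History X A T → X → ℝ
  measurable_estimate : ∀ T x, Measurable fun p => estimate T p x

namespace Algorithm

variable {d : ℕ} {S : Set (EuclideanSpace ℝ (Fin d))} {A : Type*} [MeasurableSpace A]

instance (alg : Algorithm S A) : MeasurableSpace alg.Seed := alg.measurableSpaceSeed

instance (alg : Algorithm S A) : IsProbabilityMeasure alg.seedLaw :=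
  alg.isProbabilityMeasure_seedLaw

/-- The record of seed and history after one more transition of the game, with reward `r`. -/
def extend (alg : Algorithm S A) (g : Game S A) (t : ℕ)
    (z : (alg.Seed × History S A t) × ℝ) : alg.Seed × History S A (t + 1) :=
  (z.1.1, Fin.snoc z.1.2
    ((alg.query t z.1).1, (alg.query t z.1).2, z.2, g.step (alg.query t z.1)))

/-- The joint law of the seed and of the first `T` observed transitions, when the algorithm is run
on the game `g`: given the past, the reward is drawn from the reward law of the game at the queried
state and action. -/
def runLaw (alg : Algorithm S A) (g : Game S A) :
    (T : ℕ) → Measure (alg.Seed × History S A T)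
  | 0 => alg.seedLaw.map fun ω => (ω, Fin.elim0)
  | t + 1 => (runLaw alg g t ⊗ₘ g.reward.comap (alg.query t) (alg.measurable_query t)).map
      (alg.extend g t)

theorem measurable_extend (alg : Algorithm S A) (g : Game S A) (t : ℕ) :
    Measurable (alg.extend g t) := by
  have hq : Measurable fun z : (alg.Seed × History S A t) × ℝ => alg.query t z.1 :=
    (alg.measurable_query t).comp measurable_fst
  have hs := g.measurable_step.comp hq
  refine Measurable.prodMk (by fun_prop) (measurable_pi_lambda _ fun i => ?_)
  refine Fin.lastCases ?_ (fun j => ?_) i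
  · simp only [Fin.snoc_last]
    exact hq.fst.prodMk (hq.snd.prodMk (measurable_snd.prodMk hs))
  · simp only [Fin.snoc_castSucc]
    fun_prop

instance (alg : Algorithm S A) (g : Game S A) (T : ℕ) :
    IsProbabilityMeasure (alg.runLaw g T) := by
  induction T with
  | zero => exact Measure.isProbabilityMeasure_map (by fun_prop)
  | succ t ih => exact Measure.isProbabilityMeasure_map (alg.measurable_extend g t).aemeasurable

/-- The event that the estimate `V̂_T` is at distance less than `ε` from `V` in the supremum norm
(an extended real supremum, so that unbounded differences are at distance `∞`). -/
def success (alg : Algorithm S A) (T : ℕ) (V : S → ℝ) (ε : ℝ) :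
    Set (alg.Seed × History S A T) :=
  {p | ⨆ x, ENNReal.ofReal |alg.estimate T p x - V x| < ENNReal.ofReal ε}

end Algorithm

end MarkovGame

end

namespace MarkovGame

/-! With discount factor zero and rewards that ignore the action, every policy pair is an
equilibrium and `V*` is the mean reward, so learning `V*` is learning a 1-Lipschitz function from
coin flips. Place bumps of height `±ε` on a mean of `1/2`, centred at `N ≥ c ε⁻ᵈ` points of the cube
at mutual distance at least `2ε` (`exists_separated_points`). At each centre the two candidate
values differ by `2ε`, so an estimate within less than `ε` reveals all `N` signs at once.

Changing measure to fair coins (`lintegral_runLaw_eq`), the success probability averaged over the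
sign vectors is at most `2⁻ᴺ E ∏ max(Lᵢ⁺, Lᵢ⁻)`, where `Lᵢ^±` are the likelihood ratios of bump `i`:
the success events are disjoint, and the supports are too, so likelihoods factor over the bumps.
Each `max / 2` is dominated by a potential that starts at `exp (-b)` and whose mean grows by at most
`exp (16 θ ε²)` per observation, with `θ = b / log (1 / (4b))` (`average_potential_le`). Hence the
average success at time `T` is at most `exp (16 θ ε² T - b N)` (`sum_runLaw_le`).

For `b = 1 / √N` this is below `exp (-√N / 2)` as long as `T` is at most of order `N log N / ε²`,
that is `d ε^(-(d+2)) log (1/ε)`; the logarithm is the price of having all signs right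
simultaneously. The bound is so small that it can be summed over all such `T`, which yields one game
that is hard at all these times (`exists_hard_game`). -/

/-! ### A potential for telling two hypotheses apart -/

/-- A potential that dominates half the larger of the likelihoods `x`, `y` of two hypotheses, and
that is small when both are equal to one. -/
noncomputable def potential (b θ x y : ℝ) : ℝ :=
  Real.exp (-b) * ((x + y) / 2) * ((x + y) ^ 2 / (4 * (x * y))) ^ θ

theorem potential_comm (b θ x y : ℝ) : potential b θ x y = potential b θ y x := by
  simp only [potential, add_comm x y, mul_comm x y]

theorem potential_nonneg (b θ : ℝ) {x y : ℝ} (hx : 0 ≤ x) (hy : 0 ≤ y) :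
    0 ≤ potential b θ x y := by
  unfold potential; positivity

theorem potential_one_one (b θ : ℝ) : potential b θ 1 1 = Real.exp (-b) := by
  norm_num [potential]

/-- Put `q = y / (x + y)`, the posterior weight of the other hypothesis; the claim becomes `1 - q ≤
exp (-b) (4 q (1 - q))^(-θ)`. If `q ≥ b`, then `1 - q ≤ exp (-b)` suffices. If `q < b`, the power is
at least `(1 / (4b))^θ`, and `θ` is chosen to make this exactly `exp b`. -/
theorem half_le_potential_left {b x y : ℝ} (hb : 0 < b) (hb4 : 4 * b < 1) (hx : 0 < x)
    (hy : 0 < y) : x / 2 ≤ potential b (b / Real.log (1 / (4 * b))) x y := by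
  set θ := b / Real.log (1 / (4 * b)) with hθ
  have hlog : 0 < Real.log (1 / (4 * b)) := Real.log_pos (by rw [lt_div_iff₀] <;> linarith)
  have hθ0 : 0 < θ := div_pos hb hlog
  have hs : 0 < x + y := by positivity
  suffices h : x / (x + y) ≤ Real.exp (-b) * ((x + y) ^ 2 / (4 * (x * y))) ^ θ by
    have := mul_le_mul_of_nonneg_right h (by positivity : 0 ≤ (x + y) / 2)
    calc x / 2 = x / (x + y) * ((x + y) / 2) := by field_simp
      _ ≤ _ := this
      _ = _ := by unfold potential; ring
  rcases le_or_gt b (y / (x + y)) with hq | hq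
  · have h1 : x / (x + y) ≤ Real.exp (-b) := by
      have : x / (x + y) = 1 - y / (x + y) := by field_simp; ring
      linarith [Real.add_one_le_exp (-b)]
    have h2 : 1 ≤ ((x + y) ^ 2 / (4 * (x * y))) ^ θ := by
      refine Real.one_le_rpow ?_ hθ0.le
      rw [le_div_iff₀ (by positivity)]
      nlinarith [sq_nonneg (x - y)]
    calc x / (x + y) ≤ Real.exp (-b) * 1 := by simpa using h1
      _ ≤ _ := by gcongr
  · have h1 : (1 / (4 * b)) ^ θ ≤ ((x + y) ^ 2 / (4 * (x * y))) ^ θ := by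
      refine Real.rpow_le_rpow (by positivity) ?_ hθ0.le
      rw [div_lt_iff₀ hs] at hq
      rw [div_le_div_iff₀ (by positivity) (by positivity)]
      nlinarith [mul_pos hx hy, mul_pos hs hx]
    have h2 : (1 / (4 * b)) ^ θ = Real.exp b := by
      rw [Real.rpow_def_of_pos (by positivity), hθ]
      congr 1
      field_simp
    rw [h2] at h1
    calc x / (x + y) ≤ 1 := by rw [div_le_one hs]; linarith
      _ = Real.exp (-b) * Real.exp b := by rw [← Real.exp_add]; simp
      _ ≤ _ := by gcongr

theorem half_max_le_potential {b x y : ℝ} (hb : 0 < b) (hb4 : 4 * b < 1) (hx : 0 < x)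
    (hy : 0 < y) : max x y / 2 ≤ potential b (b / Real.log (1 / (4 * b))) x y := by
  rcases max_cases x y with ⟨h, -⟩ | ⟨h, -⟩ <;> rw [h]
  · exact half_le_potential_left hb hb4 hx hy
  · rw [potential_comm]
    exact half_le_potential_left hb hb4 hy hx

/-- The update multiplies `x + y` by `1 + u` and `x y` by `1 - 4 w²`. Bernoulli's inequality, valid
since `2 θ ≤ 1`, linearizes `(1 + u)^(2θ)`, and `8 w² ≤ 1` gives `1 / (1 - 4 w²) ≤ 1 + 8 w²`. -/
theorem potential_mul_le (b : ℝ) {θ x y w : ℝ} (hθ : 0 ≤ θ) (hθ' : 2 * θ ≤ 1) (hx : 0 < x)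
    (hy : 0 < y) (hw : 8 * w ^ 2 ≤ 1) :
    potential b θ (x * (1 + 2 * w)) (y * (1 - 2 * w)) ≤
      (1 + 2 * w * (x - y) / (x + y)) * (1 + 2 * θ * (2 * w * (x - y) / (x + y))) *
        Real.exp (8 * θ * w ^ 2) * potential b θ x y := by
  have hs : 0 < x + y := by positivity
  set u := 2 * w * (x - y) / (x + y) with hu
  have hu2 : u ^ 2 ≤ 4 * w ^ 2 := by
    rw [hu, div_pow, div_le_iff₀ (by positivity)]
    have : 0 ≤ w ^ 2 * (x * y) := by positivity
    nlinarith
  have hu1 : -1 < u := by nlinarith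
  have hd : (0 : ℝ) < 1 - 4 * w ^ 2 := by linarith
  have e1 : x * (1 + 2 * w) + y * (1 - 2 * w) = (x + y) * (1 + u) := by
    rw [hu]; field_simp; ring
  have e2 : x * (1 + 2 * w) * (y * (1 - 2 * w)) = x * y * (1 - 4 * w ^ 2) := by ring
  have e3 : ((x + y) * (1 + u)) ^ 2 / (4 * (x * y * (1 - 4 * w ^ 2))) =
      (x + y) ^ 2 / (4 * (x * y)) * (1 + u) ^ 2 * (1 / (1 - 4 * w ^ 2)) := by
    field_simp
  have h1 : ((1 + u) ^ 2) ^ θ ≤ 1 + 2 * θ * u := by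
    rw [← Real.rpow_natCast, ← Real.rpow_mul (by linarith)]
    exact rpow_one_add_le_one_add_mul_self hu1.le (by simpa using hθ) (by simpa using hθ')
  have h2 : (1 / (1 - 4 * w ^ 2)) ^ θ ≤ Real.exp (8 * θ * w ^ 2) := by
    have : 1 / (1 - 4 * w ^ 2) ≤ Real.exp (8 * w ^ 2) := by
      refine le_trans ?_ (Real.add_one_le_exp _)
      rw [div_le_iff₀ hd]
      nlinarith [sq_nonneg w]
    calc (1 / (1 - 4 * w ^ 2)) ^ θ ≤ Real.exp (8 * w ^ 2) ^ θ := by gcongr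
      _ = _ := by rw [← Real.exp_mul]; ring_nf
  unfold potential
  rw [e1, e2, e3, Real.mul_rpow (by positivity) (by positivity),
    Real.mul_rpow (by positivity) (by positivity)]
  have hu0 : 0 ≤ 1 + u := by linarith
  have hu3 : 0 ≤ 1 + 2 * θ * u := h1.trans' (by positivity)
  calc _ = (1 + u) * ((1 + u) ^ 2) ^ θ * (1 / (1 - 4 * w ^ 2)) ^ θ *
        (Real.exp (-b) * ((x + y) / 2) * ((x + y) ^ 2 / (4 * (x * y))) ^ θ) := by ring
    _ ≤ _ := by gcongr

/-- One observation of a fair coin, seen as a likelihood update with bias `w`, increases the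
expected potential by a factor of at most `exp (16 θ w²)`. -/
theorem average_potential_le (b : ℝ) {θ x y w : ℝ} (hθ : 0 ≤ θ) (hθ' : 2 * θ ≤ 1) (hx : 0 < x)
    (hy : 0 < y) (hw : 8 * w ^ 2 ≤ 1) :
    (potential b θ (x * (1 + 2 * w)) (y * (1 - 2 * w)) +
      potential b θ (x * (1 - 2 * w)) (y * (1 + 2 * w))) / 2 ≤
      Real.exp (16 * θ * w ^ 2) * potential b θ x y := by
  have h1 := potential_mul_le b hθ hθ' hx hy hw
  have h2 := potential_mul_le b hθ hθ' hx hy (w := -w) (by simpa using hw)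
  have hs : 0 < x + y := by positivity
  set u := 2 * w * (x - y) / (x + y) with hu
  have hu' : 2 * -w * (x - y) / (x + y) = -u := by rw [hu]; ring
  rw [hu', neg_sq] at h2
  have hu2 : u ^ 2 ≤ 4 * w ^ 2 := by
    rw [hu, div_pow, div_le_iff₀ (by positivity)]
    have : 0 ≤ w ^ 2 * (x * y) := by positivity
    nlinarith
  have hP := potential_nonneg b θ hx.le hy.le
  have e : Real.exp (16 * θ * w ^ 2) = Real.exp (8 * θ * w ^ 2) * Real.exp (8 * θ * w ^ 2) := by
    rw [← Real.exp_add]; ring_nf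
  have h3 : 1 + 2 * θ * u ^ 2 ≤ Real.exp (8 * θ * w ^ 2) := by
    refine le_trans ?_ (Real.add_one_le_exp _)
    nlinarith
  -- The two outcomes correspond to `u` and `-u`, so the terms linear in `u` cancel in the average
  -- of `(1 + u) (1 + 2 θ u)`.
  calc _ ≤ (1 + 2 * θ * u ^ 2) * Real.exp (8 * θ * w ^ 2) * potential b θ x y := by
        simp only [mul_neg, sub_neg_eq_add, ← sub_eq_add_neg] at h2
        linarith
    _ ≤ _ := by rw [e]; gcongr

/-! ### Likelihood ratios and sign patterns -/

/-- The likelihood of the observed rewards under the mean reward `1 / 2 + w`, relative to their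
likelihood under the mean reward `1 / 2`. -/
noncomputable def likelihood {X A : Type*} (w : X → ℝ) (T : ℕ) (h : History X A T) : ℝ :=
  ∏ t, if (h t).2.2.1 = 1 then 1 + 2 * w (h t).1 else 1 - 2 * w (h t).1

section Likelihood

variable {X A : Type*}

theorem likelihood_zero (w : X → ℝ) (h : History X A 0) : likelihood w 0 h = 1 := by
  simp [likelihood]

theorem likelihood_snoc (w : X → ℝ) (T : ℕ) (h : History X A T) (o : X × A × ℝ × X) :
    likelihood w (T + 1) (Fin.snoc h o : History X A (T + 1)) =
      likelihood w T h * (if o.2.2.1 = 1 then 1 + 2 * w o.1 else 1 - 2 * w o.1) := by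
  simp [likelihood, Fin.prod_univ_castSucc]

theorem likelihood_pos {w : X → ℝ} (hw : ∀ x, 2 * |w x| < 1) (T : ℕ) (h : History X A T) :
    0 < likelihood w T h := by
  refine Finset.prod_pos fun t _ => ?_
  have h1 := hw (h t).1
  have h2 := neg_abs_le (w (h t).1)
  have h3 := le_abs_self (w (h t).1)
  split_ifs <;> linarith

theorem measurable_likelihood [MeasurableSpace X] [MeasurableSpace A] {w : X → ℝ}
    (hw : Measurable w) (T : ℕ) : Measurable (likelihood (A := A) w T) := by
  refine Finset.measurable_prod _ fun t _ => Measurable.ite ?_ (by fun_prop) (by fun_prop)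
  exact (measurable_pi_apply t).snd.snd.fst (measurableSet_singleton 1)

/-- The sum of the functions `φ i`, the `i`-th one with the sign that `v i` encodes. -/
def signedSum {ι : Type*} [Fintype ι] (φ : ι → X → ℝ) (v : ι → Bool) (x : X) : ℝ :=
  ∑ i, if v i then φ i x else -φ i x

theorem signedSum_of_forall_eq_zero {ι : Type*} [Fintype ι] {φ : ι → X → ℝ} (v : ι → Bool) {x : X}
    (h : ∀ i, φ i x = 0) : signedSum φ v x = 0 := by
  simp [signedSum, h]

theorem signedSum_of_ne {ι : Type*} [Fintype ι] {φ : ι → X → ℝ} (v : ι → Bool) {x : X} {i : ι}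
    (h : ∀ j ≠ i, φ j x = 0) : signedSum φ v x = if v i then φ i x else -φ i x :=
  Fintype.sum_eq_single i fun j hj => by simp [h j hj]

theorem measurable_signedSum [MeasurableSpace X] {ι : Type*} [Fintype ι] {φ : ι → X → ℝ}
    (hφ : ∀ i, Measurable (φ i)) (v : ι → Bool) : Measurable (signedSum φ v) := by
  refine Finset.measurable_sum _ fun i _ => ?_
  split_ifs
  exacts [hφ i, (hφ i).neg]

/-- The functions of a family have disjoint supports. -/
def DisjointSupports {ι : Type*} (φ : ι → X → ℝ) : Prop :=
  ∀ x, (∀ i, φ i x = 0) ∨ ∃ i, ∀ j ≠ i, φ j x = 0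

theorem abs_signedSum_le {ι : Type*} [Fintype ι] {φ : ι → X → ℝ} (hφ : DisjointSupports φ) {ε : ℝ}
    (hε : 0 ≤ ε) (hle : ∀ i x, |φ i x| ≤ ε) (v : ι → Bool) (x : X) : |signedSum φ v x| ≤ ε := by
  rcases hφ x with h | ⟨i, h⟩
  · simpa [signedSum_of_forall_eq_zero v h] using hε
  · rw [signedSum_of_ne v h]
    split_ifs
    · exact hle i x
    · simpa using hle i x

/-- Each observed state lies in at most one support, so in each observation all factors but at most
one equal `1`. -/
theorem likelihood_signedSum {ι : Type*} [Fintype ι] {φ : ι → X → ℝ} (hφ : DisjointSupports φ)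
    (v : ι → Bool) (T : ℕ) (h : History X A T) :
    likelihood (signedSum φ v) T h =
      ∏ i, if v i then likelihood (φ i) T h else likelihood (-φ i) T h := by
  have e : ∀ i, (if v i then likelihood (φ i) T h else likelihood (-φ i) T h) =
      ∏ t, if v i then (if (h t).2.2.1 = 1 then 1 + 2 * φ i (h t).1 else 1 - 2 * φ i (h t).1)
        else (if (h t).2.2.1 = 1 then 1 + 2 * (-φ i) (h t).1 else 1 - 2 * (-φ i) (h t).1) := by
    intro i
    split_ifs <;> rfl
  rw [Fintype.prod_congr _ _ e, Finset.prod_comm]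
  refine Finset.prod_congr rfl fun t _ => ?_
  rcases hφ (h t).1 with h0 | ⟨i, h0⟩
  · simp [signedSum_of_forall_eq_zero v h0, h0]
  · rw [signedSum_of_ne v h0, Fintype.prod_eq_single i fun j hj => by simp [h0 j hj]]
    split_ifs <;> simp

end Likelihood

/-! ### Change of measure along a run -/

theorem lintegral_bernoulliMeasure {Y : Type*} [MeasurableSpace Y] {F : Y → ℝ≥0∞}
    (hF : Measurable F) (x y : Y) (p : unitInterval) :
    ∫⁻ r, F r ∂(bernoulliMeasure x y p) =
      ENNReal.ofReal p * F x + ENNReal.ofReal (1 - p) * F y := by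
  rw [bernoulliMeasure_def, lintegral_add_measure, lintegral_smul_measure, lintegral_smul_measure,
    lintegral_dirac' _ hF, lintegral_dirac' _ hF]
  simp only [ENNReal.smul_def, smul_eq_mul]
  congr 2 <;> rw [← ENNReal.ofReal_coe_nnreal] <;> simp

namespace Algorithm

variable {d : ℕ} {S : Set (EuclideanSpace ℝ (Fin d))} {A : Type*} [MeasurableSpace A]

theorem lintegral_runLaw_succ (alg : Algorithm S A) (g : Game S A) {f : S → unitInterval}
    (hg : ∀ x a, g.reward (x, a) = bernoulliMeasure (1 : ℝ) 0 (f x)) (t : ℕ)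
    {Φ : alg.Seed × History S A (t + 1) → ℝ≥0∞} (hΦ : Measurable Φ) :
    ∫⁻ p, Φ p ∂(alg.runLaw g (t + 1)) =
      ∫⁻ z, ENNReal.ofReal (f (alg.query t z).1) * Φ (alg.extend g t (z, 1)) +
        ENNReal.ofReal (1 - f (alg.query t z).1) * Φ (alg.extend g t (z, 0)) ∂(alg.runLaw g t) := by
  have hm : Measurable fun y => Φ (alg.extend g t y) := hΦ.comp (alg.measurable_extend g t)
  rw [runLaw, lintegral_map hΦ (alg.measurable_extend g t), Measure.lintegral_compProd hm]
  refine lintegral_congr fun z => ?_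
  rw [Kernel.comap_apply, ← Prod.mk.eta (p := alg.query t z), hg]
  exact lintegral_bernoulliMeasure (hm.comp measurable_prodMk_left) _ _ _

theorem extend_snd (alg : Algorithm S A) (g : Game S A) (t : ℕ)
    (z : alg.Seed × History S A t) (r : ℝ) :
    (alg.extend g t (z, r)).2 = (Fin.snoc z.2 ((alg.query t z).1, (alg.query t z).2, r,
      g.step (alg.query t z)) : History S A (t + 1)) := rfl

theorem likelihood_extend_one (alg : Algorithm S A) (g : Game S A) (t : ℕ)
    (z : alg.Seed × History S A t) (w : S → ℝ) :
    likelihood w (t + 1) (alg.extend g t (z, 1)).2 =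
      likelihood w t z.2 * (1 + 2 * w (alg.query t z).1) := by
  rw [extend_snd, likelihood_snoc]; simp

theorem likelihood_extend_zero (alg : Algorithm S A) (g : Game S A) (t : ℕ)
    (z : alg.Seed × History S A t) (w : S → ℝ) :
    likelihood w (t + 1) (alg.extend g t (z, 0)).2 =
      likelihood w t z.2 * (1 - 2 * w (alg.query t z).1) := by
  rw [extend_snd, likelihood_snoc]; simp

theorem extend_congr (alg : Algorithm S A) {g g' : Game S A} (h : g.step = g'.step) (t : ℕ) :
    alg.extend g t = alg.extend g' t := by
  funext z
  simp only [extend, h]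

/-- Change of measure from fair coin rewards to rewards with mean `1 / 2 + w`. -/
theorem lintegral_runLaw_eq (alg : Algorithm S A) {g g₀ : Game S A} (hstep : g.step = g₀.step)
    {f f₀ : S → unitInterval} {w : S → ℝ} (hw : Measurable w) (hw2 : ∀ x, 2 * |w x| < 1)
    (hf : ∀ x, (f x : ℝ) = 1 / 2 + w x) (hf₀ : ∀ x, (f₀ x : ℝ) = 1 / 2)
    (hg : ∀ x a, g.reward (x, a) = bernoulliMeasure (1 : ℝ) 0 (f x))
    (hg₀ : ∀ x a, g₀.reward (x, a) = bernoulliMeasure (1 : ℝ) 0 (f₀ x)) (T : ℕ)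
    {Φ : alg.Seed × History S A T → ℝ≥0∞} (hΦ : Measurable Φ) :
    ∫⁻ p, Φ p ∂(alg.runLaw g T) =
      ∫⁻ p, ENNReal.ofReal (likelihood w T p.2) * Φ p ∂(alg.runLaw g₀ T) := by
  induction T with
  | zero => simp [likelihood_zero, runLaw]
  | succ t ih =>
    have hq := (alg.measurable_query t).fst
    have hext : ∀ r : ℝ, Measurable fun z : alg.Seed × History S A t => alg.extend g t (z, r) :=
      fun r => (alg.measurable_extend g t).comp (by fun_prop)
    have hl : Measurable fun p : alg.Seed × History S A (t + 1) =>
        ENNReal.ofReal (likelihood w (t + 1) p.2) * Φ p :=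
      ((measurable_likelihood hw (t + 1)).comp measurable_snd).ennreal_ofReal.mul hΦ
    rw [lintegral_runLaw_succ alg g hg t hΦ, lintegral_runLaw_succ alg g₀ hg₀ t hl, ih]
    -- The likelihood factor turns the fair weight into the biased one: `(1 ± 2 w) / 2 = 1 / 2 ± w`.
    · refine lintegral_congr fun z => ?_
      rw [extend_congr alg hstep t, likelihood_extend_one, likelihood_extend_zero, hf, hf₀]
      have h1 := hw2 (alg.query t z).1
      have h2 := neg_abs_le (w (alg.query t z).1)
      have h3 := le_abs_self (w (alg.query t z).1)
      have hl := (likelihood_pos hw2 t z.2).le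
      rw [mul_add, ← mul_assoc, ← mul_assoc, ← mul_assoc, ← mul_assoc, ← ENNReal.ofReal_mul hl,
        ← ENNReal.ofReal_mul hl, ← ENNReal.ofReal_mul (by norm_num),
        ← ENNReal.ofReal_mul (by norm_num)]
      congr 3 <;> ring
    · have h1 := hΦ.comp (hext 1)
      have h2 := hΦ.comp (hext 0)
      have h3 := hw.comp hq
      simp only [hf]
      exact ((measurable_const.add h3).ennreal_ofReal.mul h1).add
        ((measurable_const.sub (measurable_const.add h3)).ennreal_ofReal.mul h2)

/-! ### Growth of the product potential and average success -/

/-- The potentials of the pairs of likelihoods, multiplied over all `i`. -/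
noncomputable def totalPotential {X A ι : Type*} [Fintype ι] (b θ : ℝ) (φ : ι → X → ℝ) (T : ℕ)
    (h : History X A T) : ℝ :=
  ∏ i, potential b θ (likelihood (φ i) T h) (likelihood (-φ i) T h)

theorem totalPotential_nonneg {X A ι : Type*} [Fintype ι] (b θ : ℝ) {φ : ι → X → ℝ}
    (hφ : ∀ i x, 2 * |φ i x| < 1) (T : ℕ) (h : History X A T) :
    0 ≤ totalPotential b θ φ T h :=
  Finset.prod_nonneg fun i _ => potential_nonneg _ _ (likelihood_pos (hφ i) T h).le
    (likelihood_pos (w := -φ i) (by simpa using hφ i) T h).le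

theorem measurable_totalPotential {X A ι : Type*} [MeasurableSpace X] [MeasurableSpace A]
    [Fintype ι] (b θ : ℝ) {φ : ι → X → ℝ} (hφ : ∀ i, Measurable (φ i)) (T : ℕ) :
    Measurable (totalPotential (A := A) b θ φ T) := by
  refine Finset.measurable_prod _ fun i _ => ?_
  have h1 := measurable_likelihood (A := A) (hφ i) T
  have h2 := measurable_likelihood (A := A) (hφ i).neg T
  unfold potential
  fun_prop

/-- A query touches at most one bump, so at most one factor of the product moves, and
`average_potential_le` controls that factor. The rate is therefore independent of the number of
bumps. -/
theorem average_totalPotential_le {ι : Type*} [Fintype ι] (alg : Algorithm S A) (g : Game S A)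
    (b : ℝ) {θ ε : ℝ} (hθ : 0 ≤ θ) (hθ' : 2 * θ ≤ 1) {φ : ι → S → ℝ} (hd : DisjointSupports φ)
    (hφ : ∀ i x, |φ i x| ≤ ε) (hε : 8 * ε ^ 2 ≤ 1) (t : ℕ) (z : alg.Seed × History S A t) :
    (totalPotential b θ φ (t + 1) (alg.extend g t (z, 1)).2 +
      totalPotential b θ φ (t + 1) (alg.extend g t (z, 0)).2) / 2 ≤
      Real.exp (16 * θ * ε ^ 2) * totalPotential b θ φ t z.2 := by
  classical
  have hφ2 : ∀ i x, 2 * |φ i x| < 1 := fun i x => by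
    nlinarith [hφ i x, abs_nonneg (φ i x)]
  have hφε : ∀ i x, φ i x ^ 2 ≤ ε ^ 2 := fun i x =>
    sq_le_sq' (by linarith [neg_abs_le (φ i x), hφ i x]) (by linarith [le_abs_self (φ i x), hφ i x])
  have hP := totalPotential_nonneg b θ hφ2 t z.2
  have h1 : 1 ≤ Real.exp (16 * θ * ε ^ 2) := Real.one_le_exp (by positivity)
  simp only [totalPotential, likelihood_extend_one, likelihood_extend_zero, Pi.neg_apply]
  rcases hd (alg.query t z).1 with h | ⟨i, h⟩
  · simp only [h]
    have := le_mul_of_one_le_left hP h1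
    simp only [totalPotential] at this
    simpa using this
  · have hl := likelihood_pos (hφ2 i) t z.2
    have hl' := likelihood_pos (w := -φ i) (by simpa using hφ2 i) t z.2
    have key := average_potential_le b hθ hθ' hl hl' (w := φ i (alg.query t z).1)
      (by linarith [hφε i (alg.query t z).1])
    have hexp : Real.exp (16 * θ * φ i (alg.query t z).1 ^ 2) ≤ Real.exp (16 * θ * ε ^ 2) := by
      have := hφε i (alg.query t z).1
      gcongr
    have hp := potential_nonneg b θ hl.le hl'.le
    rw [← Finset.mul_prod_erase _ _ (Finset.mem_univ i),
      ← Finset.mul_prod_erase _ _ (Finset.mem_univ i),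
      ← Finset.mul_prod_erase _ _ (Finset.mem_univ i)]
    -- Here `s` stands for either likelihood update; both are trivial at bias zero, which occurs
    -- also as `-0` for the negated bump.
    have hrest : ∀ s : ℝ → ℝ → ℝ, (∀ a, s a 0 = a) → (∀ a, s a (-0) = a) →
        ∏ x ∈ Finset.univ.erase i, potential b θ
          (s (likelihood (φ x) t z.2) (φ x (alg.query t z).1))
          (s (likelihood (-φ x) t z.2) (-φ x (alg.query t z).1)) =
        ∏ x ∈ Finset.univ.erase i, potential b θ
          (likelihood (φ x) t z.2) (likelihood (-φ x) t z.2) := by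
      intro s hs hs'
      refine Finset.prod_congr rfl fun j hj => ?_
      rw [h j (Finset.ne_of_mem_erase hj), hs, hs']
    rw [hrest (fun a x => a * (1 + 2 * x)) (by simp) (by simp),
      hrest (fun a x => a * (1 - 2 * x)) (by simp) (by simp)]
    have hR : 0 ≤ ∏ x ∈ Finset.univ.erase i, potential b θ
        (likelihood (φ x) t z.2) (likelihood (-φ x) t z.2) :=
      Finset.prod_nonneg fun j _ => potential_nonneg _ _ (likelihood_pos (hφ2 j) t z.2).le
        (likelihood_pos (w := -φ j) (by simpa using hφ2 j) t z.2).le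
    rw [← add_mul, mul_div_right_comm, ← mul_assoc]
    refine mul_le_mul_of_nonneg_right ?_ hR
    refine le_trans ?_ (mul_le_mul_of_nonneg_right hexp hp)
    simpa only [mul_neg, sub_neg_eq_add, ← sub_eq_add_neg] using key

theorem lintegral_totalPotential_le {ι : Type*} [Fintype ι] (alg : Algorithm S A) (g : Game S A)
    {f : S → unitInterval} (hf : ∀ x, (f x : ℝ) = 1 / 2)
    (hg : ∀ x a, g.reward (x, a) = bernoulliMeasure (1 : ℝ) 0 (f x))
    (b : ℝ) {θ ε : ℝ} (hθ : 0 ≤ θ) (hθ' : 2 * θ ≤ 1) {φ : ι → S → ℝ} (hd : DisjointSupports φ)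
    (hm : ∀ i, Measurable (φ i)) (hφ : ∀ i x, |φ i x| ≤ ε) (hε : 8 * ε ^ 2 ≤ 1) (T : ℕ) :
    ∫⁻ p, ENNReal.ofReal (totalPotential b θ φ T p.2) ∂(alg.runLaw g T) ≤
      ENNReal.ofReal (Real.exp (16 * θ * ε ^ 2 * T - b * Fintype.card ι)) := by
  have hφ2 : ∀ i x, 2 * |φ i x| < 1 := fun i x => by
    nlinarith [hφ i x, abs_nonneg (φ i x)]
  induction T with
  | zero =>
    simp [totalPotential, likelihood_zero, potential_one_one, ← Real.exp_nat_mul, mul_comm b]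
  | succ t ih =>
    have hM : Measurable fun p : alg.Seed × History S A (t + 1) =>
        ENNReal.ofReal (totalPotential b θ φ (t + 1) p.2) :=
      ((measurable_totalPotential b θ hm (t + 1)).comp measurable_snd).ennreal_ofReal
    rw [lintegral_runLaw_succ alg g hg t hM]
    calc _ ≤ ∫⁻ z, ENNReal.ofReal (Real.exp (16 * θ * ε ^ 2)) *
          ENNReal.ofReal (totalPotential b θ φ t z.2) ∂(alg.runLaw g t) := by
          refine lintegral_mono fun z => ?_
          rw [hf, ← ENNReal.ofReal_mul (by norm_num), ← ENNReal.ofReal_mul (by norm_num),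
            ← ENNReal.ofReal_add, ← ENNReal.ofReal_mul (Real.exp_pos _).le]
          · refine ENNReal.ofReal_le_ofReal ?_
            refine le_trans (le_of_eq ?_) (average_totalPotential_le alg g b hθ hθ' hd hφ hε t z)
            ring
          · exact mul_nonneg (by norm_num) (totalPotential_nonneg b θ hφ2 _ _)
          · exact mul_nonneg (by norm_num) (totalPotential_nonneg b θ hφ2 _ _)
      _ = ENNReal.ofReal (Real.exp (16 * θ * ε ^ 2)) *
          ∫⁻ z, ENNReal.ofReal (totalPotential b θ φ t z.2) ∂(alg.runLaw g t) :=
          lintegral_const_mul' _ _ ENNReal.ofReal_ne_top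
      _ ≤ _ := by
          grw [ih]
          rw [← ENNReal.ofReal_mul (Real.exp_pos _).le, ← Real.exp_add]
          refine le_of_eq ?_
          congr 2
          push_cast
          ring

/-- If the mean rewards `1 / 2 ± φ i` of the games `g v` have to be told apart by the disjoint
events `D v`, then the average success probability is small. -/
theorem sum_runLaw_le {ι : Type*} [Fintype ι] [DecidableEq ι] (alg : Algorithm S A)
    {g : (ι → Bool) → Game S A} {g₀ : Game S A} (hstep : ∀ v, (g v).step = g₀.step)
    {φ : ι → S → ℝ} {f : (ι → Bool) → S → unitInterval} {f₀ : S → unitInterval}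
    (hf : ∀ v x, (f v x : ℝ) = 1 / 2 + signedSum φ v x) (hf₀ : ∀ x, (f₀ x : ℝ) = 1 / 2)
    (hg : ∀ v x a, (g v).reward (x, a) = bernoulliMeasure (1 : ℝ) 0 (f v x))
    (hg₀ : ∀ x a, g₀.reward (x, a) = bernoulliMeasure (1 : ℝ) 0 (f₀ x))
    {b ε : ℝ} (hb : 0 < b) (hb4 : 4 * b < 1) (hθ : 2 * (b / Real.log (1 / (4 * b))) ≤ 1)
    (hd : DisjointSupports φ) (hm : ∀ i, Measurable (φ i)) (hφ : ∀ i x, |φ i x| ≤ ε)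
    (hε₀ : 0 ≤ ε) (hε : 8 * ε ^ 2 ≤ 1) (T : ℕ) {D : (ι → Bool) → Set (alg.Seed × History S A T)}
    (hD : ∀ v, MeasurableSet (D v)) (hdisj : Pairwise (Function.onFun Disjoint D)) :
    ∑ v, alg.runLaw (g v) T (D v) ≤ 2 ^ Fintype.card ι * ENNReal.ofReal
      (Real.exp (16 * (b / Real.log (1 / (4 * b))) * ε ^ 2 * T - b * Fintype.card ι)) := by
  have hφ2 : ∀ i x, 2 * |φ i x| < 1 := fun i x => by
    nlinarith [hφ i x, abs_nonneg (φ i x)]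
  have hθ0 : 0 ≤ b / Real.log (1 / (4 * b)) :=
    div_nonneg hb.le (Real.log_nonneg (by rw [le_div_iff₀] <;> linarith))
  have hs2 : ∀ v x, 2 * |signedSum φ v x| < 1 := fun v x => by
    nlinarith [abs_signedSum_le hd hε₀ hφ v x, abs_nonneg (signedSum φ v x)]
  have hsm := fun v => measurable_signedSum hm v
  have h1 : ∀ v, alg.runLaw (g v) T (D v) = ∫⁻ p,
      ENNReal.ofReal (likelihood (signedSum φ v) T p.2) * (D v).indicator 1 p
        ∂(alg.runLaw g₀ T) := fun v => by
    rw [← lintegral_indicator_one (hD v)]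
    exact lintegral_runLaw_eq alg (hstep v) (hsm v) (hs2 v) (hf v) hf₀ (hg v) hg₀ T
      (measurable_one.indicator (hD v))
  have h2 : ∀ p : alg.Seed × History S A T,
      ∑ v, ENNReal.ofReal (likelihood (signedSum φ v) T p.2) * (D v).indicator 1 p ≤
        2 ^ Fintype.card ι * ENNReal.ofReal
          (totalPotential b (b / Real.log (1 / (4 * b))) φ T p.2) := by
    intro p
    -- Disjointness leaves at most one nonzero term, and the bound on it does not depend on which
    -- `v` it is.
    by_cases hp : ∃ v, p ∈ D v
    · obtain ⟨v, hv⟩ := hp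
      rw [Fintype.sum_eq_single v]
      · rw [Set.indicator_of_mem hv, Pi.one_apply, mul_one, likelihood_signedSum hd]
        have : (2 : ℝ≥0∞) ^ Fintype.card ι = ENNReal.ofReal (2 ^ Fintype.card ι) := by
          rw [ENNReal.ofReal_pow (by norm_num)]; norm_num
        rw [this, ← ENNReal.ofReal_mul (by positivity)]
        refine ENNReal.ofReal_le_ofReal ?_
        rw [totalPotential, ← Finset.card_univ, ← Finset.prod_const, ← Finset.prod_mul_distrib]
        have hl := fun i => likelihood_pos (hφ2 i) T p.2
        have hl' := fun i => likelihood_pos (w := -φ i) (by simpa using hφ2 i) T p.2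
        refine Finset.prod_le_prod (fun i _ => ?_) fun i _ => ?_
        · split_ifs
          exacts [(hl i).le, (hl' i).le]
        · have := half_max_le_potential hb hb4 (hl i) (hl' i)
          split_ifs
          · linarith [le_max_left (likelihood (φ i) T p.2) (likelihood (-φ i) T p.2)]
          · linarith [le_max_right (likelihood (φ i) T p.2) (likelihood (-φ i) T p.2)]
      · intro v' hv'
        rw [Set.indicator_of_notMem, mul_zero]
        exact fun hp => (Set.disjoint_left.1 (hdisj hv')) hp hv
    · push Not at hp
      simp [hp]
  calc ∑ v, alg.runLaw (g v) T (D v)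
      = ∫⁻ p, ∑ v, ENNReal.ofReal (likelihood (signedSum φ v) T p.2) * (D v).indicator 1 p
          ∂(alg.runLaw g₀ T) := by
        rw [lintegral_finsetSum]
        · exact Finset.sum_congr rfl fun v _ => h1 v
        · exact fun v _ => ((measurable_likelihood (hsm v) T).comp measurable_snd).ennreal_ofReal.mul
            (measurable_one.indicator (hD v))
    _ ≤ ∫⁻ p, 2 ^ Fintype.card ι * ENNReal.ofReal
          (totalPotential b (b / Real.log (1 / (4 * b))) φ T p.2) ∂(alg.runLaw g₀ T) :=
        lintegral_mono h2
    _ = 2 ^ Fintype.card ι * ∫⁻ p, ENNReal.ofReal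
          (totalPotential b (b / Real.log (1 / (4 * b))) φ T p.2) ∂(alg.runLaw g₀ T) :=
        lintegral_const_mul' _ _ (by finiteness)
    _ ≤ _ := by
        grw [lintegral_totalPotential_le alg g₀ hf₀ hg₀ b hθ0 hθ hd hm hφ hε T]

end Algorithm

/-! ### Packing the cube, uniformly in the dimension -/

theorem Gamma_floor_le {d : ℕ} (hd : 2 ≤ d) :
    ((d / 2).factorial : ℝ) ≤ Real.Gamma (d / 2 + 1) := by
  rw [← Real.Gamma_nat_eq_factorial]
  have h1 : (1 : ℝ) ≤ (d / 2 : ℕ) := by exact_mod_cast (by omega : 1 ≤ d / 2)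
  have h2 : ((d / 2 : ℕ) : ℝ) ≤ d / 2 := Nat.cast_div_le
  exact Real.Gamma_strictMonoOn_Ici.monotoneOn (by simp; linarith) (by simp; linarith)
    (by linarith)

/-- The volumes of the Euclidean balls of radius two are bounded uniformly in the dimension. -/
theorem exists_volume_ball_two_le : ∃ K : ℝ, 0 < K ∧ ∀ d : ℕ,
    2 ^ d * (√Real.pi ^ d / Real.Gamma (d / 2 + 1)) ≤ K := by
  have hlim := FloorSemiring.tendsto_pow_div_factorial_atTop (4 * Real.pi)
  obtain ⟨K₀, hK₀⟩ := hlim.bddAbove_range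
  have hK : ∀ n : ℕ, (4 * Real.pi) ^ n / n.factorial ≤ K₀ := fun n => hK₀ ⟨n, rfl⟩
  have hπ := Real.pi_pos
  have hs := Real.sqrt_pos.2 hπ
  have hK1 : 1 ≤ K₀ := by simpa using hK 0
  have hG := Real.Gamma_pos_of_pos (show (0 : ℝ) < (1 : ℕ) / 2 + 1 by norm_num)
  -- The three summands serve `d ≥ 2`, `d = 0` and `d = 1`: `Γ` is increasing only from `2` on in
  -- the comparison used, so `d = 1` enters by its own value.
  refine ⟨(1 + 2 * √Real.pi) * K₀ + 1 +
    2 ^ 1 * (√Real.pi ^ 1 / Real.Gamma ((1 : ℕ) / 2 + 1)), by positivity, fun d => ?_⟩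
  have hpos : 0 ≤ 2 ^ 1 * (√Real.pi ^ 1 / Real.Gamma ((1 : ℕ) / 2 + 1)) := by positivity
  have hpos' : 0 ≤ (1 + 2 * √Real.pi) * K₀ := by positivity
  rcases Nat.lt_or_ge d 2 with hd | hd
  · interval_cases d
    · simp only [Nat.cast_zero, zero_div, zero_add, Real.Gamma_one, pow_zero] at *
      linarith
    · linarith
  · have hfac : (0 : ℝ) < (d / 2).factorial := by positivity
    have h4 : (2 * √Real.pi) ^ 2 = 4 * Real.pi := by
      rw [mul_pow, Real.sq_sqrt hπ.le]; norm_num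
    have hpow : (2 * √Real.pi) ^ d ≤ (1 + 2 * √Real.pi) * (4 * Real.pi) ^ (d / 2) := by
      conv_lhs => rw [← Nat.div_add_mod d 2, pow_add, pow_mul, h4, mul_comm]
      refine mul_le_mul_of_nonneg_right ?_ (by positivity)
      rcases Nat.mod_two_eq_zero_or_one d with h | h <;> rw [h] <;> simp
    calc 2 ^ d * (√Real.pi ^ d / Real.Gamma (d / 2 + 1))
        = (2 * √Real.pi) ^ d / Real.Gamma (d / 2 + 1) := by rw [mul_pow]; ring
      _ ≤ (1 + 2 * √Real.pi) * (4 * Real.pi) ^ (d / 2) / (d / 2).factorial := by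
          have := Gamma_floor_le hd
          gcongr
      _ = (1 + 2 * √Real.pi) * ((4 * Real.pi) ^ (d / 2) / (d / 2).factorial) := by ring
      _ ≤ (1 + 2 * √Real.pi) * K₀ := by gcongr; exact hK _
      _ ≤ _ := by linarith

theorem cube_eq_preimage (d : ℕ) :
    cube d = WithLp.ofLp ⁻¹' (Set.univ.pi fun _ => Set.Icc (0 : ℝ) 1) := by
  ext x; simp [cube, Pi.le_def, forall_and]

theorem volume_cube (d : ℕ) : volume (cube d) = 1 := by
  rw [cube_eq_preimage, (PiLp.volume_preserving_ofLp (Fin d)).measure_preimage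
    (MeasurableSet.univ_pi fun _ => measurableSet_Icc).nullMeasurableSet, volume_pi_pi]
  simp

theorem isCompact_cube (d : ℕ) : IsCompact (cube d) := by
  rw [cube_eq_preimage]
  exact (PiLp.homeomorph 2 fun _ : Fin d => ℝ).isCompact_preimage.2
    (isCompact_univ_pi fun _ => isCompact_Icc)

/-- The cube contains at least `c ε⁻ᵈ` points at distances at least `2 ε`, where `c` does not
depend on the dimension. -/
theorem exists_separated_points : ∃ c : ℝ, 0 < c ∧ ∀ d : ℕ, 1 ≤ d → ∀ ε : ℝ, 0 < ε →
    ∃ C : Finset (cube d), c * ε⁻¹ ^ d ≤ C.card ∧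
      ∀ x ∈ C, ∀ y ∈ C, x ≠ y → 2 * ε ≤ dist x y := by
  obtain ⟨K, hK, hball⟩ := exists_volume_ball_two_le
  refine ⟨K⁻¹, inv_pos.2 hK, fun d hd ε hε => ?_⟩
  have : Nonempty (Fin d) := ⟨⟨0, hd⟩⟩
  have : CompactSpace (cube d) := isCompact_iff_compactSpace.1 (isCompact_cube d)
  lift ε to NNReal using hε.le
  have hε0 : ε ≠ 0 := by rintro rfl; simp at hε
  -- A finite cover at scale `ε`, from compactness, bounds the packing number at scale `2 ε`.
  have hfin : Metric.packingNumber (2 * ε) (Set.univ : Set (cube d)) ≠ ⊤ := by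
    obtain ⟨N, -, hN, hc⟩ := Metric.exists_finite_isCover_of_isCompact hε0
      (isCompact_univ (X := cube d))
    exact ne_top_of_le_ne_top (by simpa using hN)
      ((Metric.packingNumber_two_mul_le_externalCoveringNumber ε _).trans
        hc.externalCoveringNumber_le_encard)
  set M := Metric.maximalSeparatedSet (2 * ε) (Set.univ : Set (cube d)) with hM
  have hMfin : M.Finite := by
    rw [← Set.encard_ne_top_iff, hM, Metric.encard_maximalSeparatedSet hfin]
    exact hfin
  have hcov := Metric.isCover_maximalSeparatedSet hfin
  have hsep : Metric.IsSeparated _ M := Metric.isSeparated_maximalSeparatedSet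
  refine ⟨hMfin.toFinset, ?_, fun x hx y hy hxy => ?_⟩
  · have hsub : cube d ⊆ ⋃ y ∈ hMfin.toFinset,
        Metric.closedBall (y : EuclideanSpace ℝ (Fin d)) (2 * ε) := by
      intro x hx
      have := Metric.isCover_iff_subset_iUnion_closedBall.1 hcov (Set.mem_univ ⟨x, hx⟩)
      simp only [Set.mem_iUnion, exists_prop] at this ⊢
      obtain ⟨y, hy, hxy⟩ := this
      exact ⟨y, by simpa using hy, by simpa [Subtype.dist_eq] using hxy⟩
    have hvol : (1 : ℝ≥0∞) ≤ hMfin.toFinset.card * ENNReal.ofReal (ε ^ d * K) := by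
      calc (1 : ℝ≥0∞) = volume (cube d) := (volume_cube d).symm
        _ ≤ ∑ y ∈ hMfin.toFinset, volume
            (Metric.closedBall (y : EuclideanSpace ℝ (Fin d)) (2 * ε)) :=
            (measure_mono hsub).trans (measure_biUnion_finset_le _ _)
        _ ≤ ∑ y ∈ hMfin.toFinset, ENNReal.ofReal (ε ^ d * K) := by
            refine Finset.sum_le_sum fun y _ => ?_
            rw [EuclideanSpace.volume_closedBall, Fintype.card_fin,
              ← ENNReal.ofReal_pow (by positivity), ← ENNReal.ofReal_mul (by positivity)]
            refine ENNReal.ofReal_le_ofReal ?_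
            rw [mul_pow, mul_comm (2 ^ d), mul_assoc]
            exact mul_le_mul_of_nonneg_left (hball d) (by positivity)
        _ = _ := by rw [Finset.sum_const, nsmul_eq_mul]
    have hreal : 1 ≤ (hMfin.toFinset.card : ℝ) * (ε ^ d * K) := by
      rw [← ENNReal.ofReal_natCast, ← ENNReal.ofReal_mul (by positivity)] at hvol
      exact ENNReal.one_le_ofReal.1 hvol
    rw [← mul_inv_cancel_right₀ (b := (ε : ℝ) ^ d * K) (by positivity)
      (hMfin.toFinset.card : ℝ)]
    rw [inv_pow, ← mul_inv, mul_comm K]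
    exact le_mul_of_one_le_left (by positivity) hreal
  · have h : _ < edist x y := hsep (by simpa using hx) (by simpa using hy) hxy
    rw [edist_nndist, ENNReal.coe_lt_coe] at h
    exact_mod_cast h.le

/-! ### Games with discount factor zero -/

theorem measurable_bernoulliMeasure {Y : Type*} [MeasurableSpace Y] (x y : Y) :
    Measurable fun p : unitInterval => bernoulliMeasure x y p := by
  classical
  refine Measure.measurable_of_measurable_coe _ fun s hs => ?_
  simp only [bernoulliMeasure_apply _ hs]
  have h : Measurable unitInterval.toNNReal := unitInterval.toNNReal_continuous.measurable
  have h' : Measurable fun p => unitInterval.toNNReal (unitInterval.symm p) :=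
    h.comp unitInterval.continuous_symm.measurable
  split_ifs
  exacts [measurable_const, h.coe_nnreal_ennreal, h'.coe_nnreal_ennreal, measurable_const]

section Games

variable {d : ℕ} {S : Set (EuclideanSpace ℝ (Fin d))} {A : Type*} [MeasurableSpace A]

/-- The game with discount factor zero and Bernoulli rewards of mean `f`. -/
noncomputable def bernoulliGame (hS : IsCompact S) {S₁ : Set S} (hS₁ : MeasurableSet S₁)
    {step : S × A → S} (hstep : Measurable step) {f : S → unitInterval} (hf : Measurable f) :
    Game S A where
  isCompact_states := hS
  S₁ := S₁
  measurableSet_S₁ := hS₁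
  step := step
  measurable_step := hstep
  reward := ⟨fun z => bernoulliMeasure (1 : ℝ) 0 (f z.1),
    (measurable_bernoulliMeasure 1 0).comp (hf.comp measurable_fst)⟩
  markov_reward := ⟨fun z =>
    inferInstanceAs (IsProbabilityMeasure (bernoulliMeasure (1 : ℝ) 0 (f z.1)))⟩
  Rmax := 1
  Rmax_pos := one_pos
  reward_bounded z := by
    change ∀ᵐ r ∂(bernoulliMeasure (1 : ℝ) 0 (f z.1)), r ∈ Set.Icc (-1 : ℝ) 1
    rw [ae_iff]
    change (bernoulliMeasure (1 : ℝ) 0 (f z.1)) (Set.Icc (-1 : ℝ) 1)ᶜ = 0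
    exact bernoulliMeasure_apply_of_notMem_of_notMem _ measurableSet_Icc.compl (by simp) (by simp)
  γ := 0
  γ_nonneg := le_rfl
  γ_lt_one := one_pos

namespace Game

theorem map_eval_zero_playLaw (g : Game S A) (π₁ : g.Policy₁) (π₂ : g.Policy₂) (s : S) :
    (g.playLaw π₁ π₂ s).map (fun ω => ω 0) = g.round π₁ π₂ s := by
  have h : (fun ω : ℕ → S × A × ℝ => ω 0) =
      (fun x : ∀ _ : Finset.Iic 0, S × A × ℝ => x ⟨0, by simp⟩) ∘
        Preorder.frestrictLe (π := fun _ => S × A × ℝ) 0 := rfl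
  rw [h, ← Measure.map_map (measurable_pi_apply _) (by fun_prop), playLaw, Kernel.trajMeasure,
    Measure.map_comp _ _ (by fun_prop), Kernel.traj_map_frestrictLe, Kernel.partialTraj_self,
    Measure.id_comp, Measure.map_map (measurable_pi_apply _) (by fun_prop)]
  exact Measure.map_id

theorem map_reward_round (g : Game S A) {f : S → unitInterval}
    (hg : ∀ x a, g.reward (x, a) = bernoulliMeasure (1 : ℝ) 0 (f x)) (π₁ : g.Policy₁)
    (π₂ : g.Policy₂) (s : S) :
    (g.round π₁ π₂ s).map (fun z => z.2.2) = bernoulliMeasure (1 : ℝ) 0 (f s) := by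
  have h : (fun z : S × A × ℝ => z.2.2) = Prod.snd ∘ Prod.snd := rfl
  rw [h, ← Measure.map_map measurable_snd measurable_snd, ← Kernel.snd_apply, round,
    Kernel.snd_prod]
  ext B hB
  rw [Measure.map_apply measurable_snd hB, Kernel.compProd_apply (measurable_snd hB)]
  simp only [hg, Set.preimage, Set.mem_ofPred_eq, Set.ofPred_mem_eq]
  simp

theorem value_of_discount_zero (g : Game S A) (hγ : g.γ = 0) {f : S → unitInterval}
    (hg : ∀ x a, g.reward (x, a) = bernoulliMeasure (1 : ℝ) 0 (f x)) (π₁ : g.Policy₁)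
    (π₂ : g.Policy₂) (s : S) : g.value π₁ π₂ s = f s := by
  -- Only `k = 0` survives, because `0 ^ 0 = 1`.
  have h : ∀ ω : ℕ → S × A × ℝ, ∑' k : ℕ, g.γ ^ k * (ω k).2.2 = (ω 0).2.2 := fun ω => by
    rw [tsum_eq_single 0 fun k hk => by simp [hγ, hk]]
    simp
  have hm : Measurable fun z : S × A × ℝ => z.2.2 := by fun_prop
  have he : Measurable fun ω : ℕ → S × A × ℝ => ω 0 := measurable_pi_apply 0
  simp only [value, h]
  calc ∫ ω, (ω 0).2.2 ∂(g.playLaw π₁ π₂ s)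
      = ∫ z, z.2.2 ∂((g.playLaw π₁ π₂ s).map fun ω => ω 0) :=
        (integral_map he.aemeasurable hm.aestronglyMeasurable).symm
    _ = ∫ r, r ∂((g.round π₁ π₂ s).map fun z => z.2.2) := by
        rw [map_eval_zero_playLaw]
        exact (integral_map hm.aemeasurable aestronglyMeasurable_id).symm
    _ = f s := by
        rw [map_reward_round g hg, integral_bernoulliMeasure]
        simp

/-- The value does not depend on the policies, so any pair is an equilibrium; constant ones serve as
witnesses. -/
theorem isOptimalValue_of_discount_zero [Nonempty A] (g : Game S A) (hγ : g.γ = 0)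
    {f : S → unitInterval}
    (hg : ∀ x a, g.reward (x, a) = bernoulliMeasure (1 : ℝ) 0 (f x)) :
    g.IsOptimalValue fun s => f s := by
  have hv := fun π₁ π₂ s => g.value_of_discount_zero hγ hg π₁ π₂ s
  obtain ⟨a⟩ := ‹Nonempty A›
  refine ⟨⟨⟨Kernel.const _ (Measure.dirac a), inferInstance⟩,
    ⟨Kernel.const _ (Measure.dirac a), inferInstance⟩, ?_, ?_⟩, fun π₁ π₂ _ => funext (hv π₁ π₂)⟩
  · exact fun π s => (hv π _ s).trans_le (hv _ _ s).ge
  · exact fun π s => (hv _ _ s).trans_le (hv _ π s).ge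

end Game

end Games

/-! ### Bumps at separated centres -/

/-- The bump of height and radius `ε` around `c`. -/
noncomputable def bump {X : Type*} [PseudoMetricSpace X] (ε : ℝ) (c x : X) : ℝ :=
  max (ε - dist x c) 0

section Bump

variable {X : Type*} [PseudoMetricSpace X] {ε : ℝ}

theorem bump_nonneg (c x : X) : 0 ≤ bump ε c x := le_max_right _ _

theorem bump_self (hε : 0 ≤ ε) (c : X) : bump ε c c = ε := by simp [bump, hε]

theorem abs_bump_le (hε : 0 ≤ ε) (c x : X) : |bump ε c x| ≤ ε := by
  rw [abs_of_nonneg (bump_nonneg c x)]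
  exact max_le (by linarith [dist_nonneg (x := x) (y := c)]) hε

theorem bump_eq_zero {c x : X} (h : ε ≤ dist x c) : bump ε c x = 0 := max_eq_right (by linarith)

theorem dist_lt_of_bump_ne_zero {c x : X} (h : bump ε c x ≠ 0) : dist x c < ε := by
  contrapose! h
  exact bump_eq_zero h

theorem abs_bump_sub_le (c x y : X) : |bump ε c x - bump ε c y| ≤ dist x y := by
  refine (abs_max_sub_max_le_abs _ _ _).trans ?_
  rw [sub_sub_sub_cancel_left, dist_comm x y]
  exact abs_dist_sub_le y x c

theorem measurable_bump [MeasurableSpace X] [OpensMeasurableSpace X] (c : X) :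
    Measurable (bump ε c) := by
  refine Continuous.measurable ?_
  unfold bump
  fun_prop

variable {ι : Type*} {c : ι → X}

theorem disjointSupports_bump (hc : ∀ i j, i ≠ j → 2 * ε ≤ dist (c i) (c j)) :
    DisjointSupports fun i => bump ε (c i) := by
  intro x
  by_cases h : ∃ i, bump ε (c i) x ≠ 0
  · obtain ⟨i, hi⟩ := h
    refine Or.inr ⟨i, fun j hj => bump_eq_zero ?_⟩
    have h1 := dist_lt_of_bump_ne_zero hi
    have h2 := hc j i hj
    have h3 := dist_triangle_left (c j) (c i) x
    linarith
  · push Not at h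
    exact Or.inl h

/-- If one bump accounts for both points, its own Lipschitz bound applies. Otherwise the points lie
in different supports, and the heights `ε - dist x (c i)` and `ε - dist y (c j)` add up to at most
`dist x y` because the centres are at least `2 ε` apart. -/
theorem abs_signedSum_bump_sub_le [Fintype ι] (hc : ∀ i j, i ≠ j → 2 * ε ≤ dist (c i) (c j))
    (v : ι → Bool) (x y : X) :
    |signedSum (fun i => bump ε (c i)) v x - signedSum (fun i => bump ε (c i)) v y| ≤ dist x y := by
  have hsame : ∀ i, (∀ j ≠ i, bump ε (c j) x = 0) → (∀ j ≠ i, bump ε (c j) y = 0) →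
      |signedSum (fun i => bump ε (c i)) v x - signedSum (fun i => bump ε (c i)) v y| ≤
        dist x y := by
    intro i hx hy
    rw [signedSum_of_ne v hx, signedSum_of_ne v hy]
    have h := abs_bump_sub_le (ε := ε) (c i) x y
    split_ifs
    · exact h
    · rwa [neg_sub_neg, abs_sub_comm]
  rcases disjointSupports_bump hc x with hx | ⟨i, hx⟩ <;>
    rcases disjointSupports_bump hc y with hy | ⟨j, hy⟩
  · rw [signedSum_of_forall_eq_zero v hx, signedSum_of_forall_eq_zero v hy]
    simp
  · exact hsame j (fun k _ => hx k) hy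
  · exact hsame i hx fun k _ => hy k
  · by_cases hij : i = j
    · exact hsame i hx (hij ▸ hy)
    by_cases hi0 : bump ε (c i) x = 0
    · refine hsame j (fun k _ => ?_) hy
      by_cases hk : k = i
      exacts [hk ▸ hi0, hx k hk]
    by_cases hj0 : bump ε (c j) y = 0
    · refine hsame i hx fun k _ => ?_
      by_cases hk : k = j
      exacts [hk ▸ hj0, hy k hk]
    rw [signedSum_of_ne v hx, signedSum_of_ne v hy]
    have h1 := dist_lt_of_bump_ne_zero hi0
    have h2 := dist_lt_of_bump_ne_zero hj0
    have e1 : bump ε (c i) x = ε - dist x (c i) := max_eq_left (by linarith)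
    have e2 : bump ε (c j) y = ε - dist y (c j) := max_eq_left (by linarith)
    have h3 := hc i j hij
    have h4 := dist_triangle4 (c i) x y (c j)
    rw [dist_comm (c i) x] at h4
    have h5 := dist_nonneg (x := x) (y := y)
    simp only [e1, e2]
    rw [abs_le]
    split_ifs <;> constructor <;> linarith

theorem signedSum_bump_center [Fintype ι] (hε : 0 < ε)
    (hc : ∀ i j, i ≠ j → 2 * ε ≤ dist (c i) (c j)) (v : ι → Bool) (i : ι) :
    signedSum (fun i => bump ε (c i)) v (c i) = if v i then ε else -ε := by
  rw [signedSum_of_ne v (i := i), bump_self hε.le]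
  intro j hj
  exact bump_eq_zero (by linarith [hc i j hj.symm])

end Bump

/-! ### The hard game -/

/-- Given many separated points, some game with bumps of height `± ε` at these points is hard to
learn for the given algorithm at every time before `τ`. -/
theorem exists_hard_game {d : ℕ} {S : Set (EuclideanSpace ℝ (Fin d))} (hS : IsCompact S)
    {A : Type*} [Nonempty A] [MeasurableSpace A] {S₁ : Set S} (hS₁ : MeasurableSet S₁)
    {step : S × A → S} (hstep : Measurable step) (alg : Algorithm S A) {ε b δ τ : ℝ}
    (hε : 0 < ε) (hε' : ε ≤ 1 / 4) {C : Finset S}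
    (hC : ∀ x ∈ C, ∀ y ∈ C, x ≠ y → 2 * ε ≤ dist x y)
    (hb : 0 < b) (hb4 : 4 * b < 1) (hθ : 2 * (b / Real.log (1 / (4 * b))) ≤ 1)
    (hτ : 0 ≤ τ) (hτ1 : 16 * (b / Real.log (1 / (4 * b))) * ε ^ 2 * τ ≤ b * C.card / 2)
    (hτ2 : (τ + 1) * Real.exp (-(b * C.card / 2)) < 1 - δ) :
    ∃ (g : Game S A) (f : S → unitInterval) (V : S → ℝ),
      g.S₁ = S₁ ∧ g.step = step ∧ g.γ = 0 ∧ LipschitzWith 1 f ∧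
      (∀ x a, g.reward (x, a) = bernoulliMeasure (1 : ℝ) 0 (f x)) ∧
      g.IsOptimalValue V ∧
      ∀ T : ℕ, ENNReal.ofReal (1 - δ) ≤ alg.runLaw g T (alg.success T V ε) → τ ≤ T := by
  classical
  have hc : ∀ i j : C, i ≠ j → 2 * ε ≤ dist (i : S) (j : S) := fun i j hij =>
    hC i i.2 j j.2 fun h => hij (Subtype.ext h)
  set φ : C → S → ℝ := fun i => bump ε (i : S) with hφ
  have hd : DisjointSupports φ := disjointSupports_bump hc
  have hφε : ∀ i x, |φ i x| ≤ ε := fun i x => abs_bump_le hε.le _ x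
  have hφm : ∀ i, Measurable (φ i) := fun i => measurable_bump _
  have hsum := fun v x => abs_le.1 (abs_signedSum_le hd hε.le hφε v x)
  have hmem : ∀ v x, 1 / 2 + signedSum φ v x ∈ unitInterval := fun v x =>
    ⟨by linarith [(hsum v x).1], by linarith [(hsum v x).2]⟩
  set f : (C → Bool) → S → unitInterval := fun v x => ⟨1 / 2 + signedSum φ v x, hmem v x⟩ with hf
  have hlip : ∀ v, LipschitzWith 1 (f v) := fun v => LipschitzWith.mk_one fun x y => by
    rw [Subtype.dist_eq, Real.dist_eq]
    simpa [hf] using abs_signedSum_bump_sub_le hc v x y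
  set f₀ : S → unitInterval := fun _ => ⟨1 / 2, by norm_num, by norm_num⟩ with hf₀
  set G := fun v => bernoulliGame hS hS₁ hstep (hlip v).continuous.measurable with hG
  set g₀ := bernoulliGame hS hS₁ hstep (f := f₀) measurable_const with hg₀
  by_contra! hcon
  -- The time of success may depend on `v`; summing over all `T < τ` below removes this dependence.
  have hbad : ∀ v, ∃ T : ℕ, ENNReal.ofReal (1 - δ) ≤
      alg.runLaw (G v) T (alg.success T (fun x => f v x) ε) ∧ (T : ℝ) < τ := fun v =>
    hcon (G v) (f v) _ rfl rfl rfl (hlip v) (fun _ _ => rfl)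
      ((G v).isOptimalValue_of_discount_zero rfl fun _ _ => rfl)
  -- The success event involves a supremum over uncountably many states and need not be measurable.
  -- Testing at the finitely many centres gives a measurable set containing it.
  set D : (T : ℕ) → (C → Bool) → Set (alg.Seed × History S A T) := fun T v =>
    ⋂ i : C, {p | |alg.estimate T p i - f v i| < ε} with hD
  have hDm : ∀ T v, MeasurableSet (D T v) := fun T v => MeasurableSet.iInter fun i =>
    measurableSet_lt ((alg.measurable_estimate T i).sub measurable_const).abs measurable_const
  have hDdisj : ∀ T, Pairwise (Function.onFun Disjoint (D T)) := by
    intro T v v' hvv'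
    obtain ⟨i, hi⟩ := Function.ne_iff.1 hvv'
    refine Set.disjoint_left.2 fun p hp hp' => ?_
    have h1 : |alg.estimate T p i - f v i| < ε := Set.mem_iInter.1 hp i
    have h2 : |alg.estimate T p i - f v' i| < ε := Set.mem_iInter.1 hp' i
    rw [abs_lt] at h1 h2
    simp only [hf, hφ, signedSum_bump_center hε hc] at h1 h2
    cases hv : v i <;> cases hv' : v' i <;> simp only [hv, hv', ne_eq, not_true_eq_false] at hi <;>
      simp [hv, hv'] at h1 h2 <;> linarith
  have hsucc : ∀ T v, alg.success T (fun x => f v x) ε ⊆ D T v := by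
    intro T v p hp
    refine Set.mem_iInter.2 fun i => ?_
    exact (ENNReal.ofReal_lt_ofReal_iff hε).1
      ((le_iSup (fun x => ENNReal.ofReal |alg.estimate T p x - f v x|) i).trans_lt hp)
  have hup : ∀ T ∈ Finset.range ⌈τ⌉₊, ∑ v, alg.runLaw (G v) T (D T v) ≤
      2 ^ C.card * ENNReal.ofReal (Real.exp (-(b * C.card / 2))) := by
    intro T hT
    have hTτ : (T : ℝ) < τ := Nat.lt_ceil.1 (Finset.mem_range.1 hT)
    have hmain := alg.sum_runLaw_le (g := G) (g₀ := g₀) (f := f) (f₀ := f₀) (fun _ => rfl)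
      (fun _ _ => rfl) (fun _ => rfl) (fun _ _ _ => rfl) (fun _ _ => rfl) hb hb4 hθ hd hφm hφε
      hε.le (by nlinarith) T (hDm T) (hDdisj T)
    rw [Fintype.card_coe] at hmain
    refine hmain.trans (mul_le_mul_right (ENNReal.ofReal_le_ofReal (Real.exp_le_exp.2 ?_)) _)
    have hθ0 : 0 ≤ b / Real.log (1 / (4 * b)) :=
      div_nonneg hb.le (Real.log_nonneg (by rw [le_div_iff₀] <;> linarith))
    have : 16 * (b / Real.log (1 / (4 * b))) * ε ^ 2 * T ≤
        16 * (b / Real.log (1 / (4 * b))) * ε ^ 2 * τ := by gcongr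
    linarith
  have hlow : ∀ v, ENNReal.ofReal (1 - δ) ≤
      ∑ T ∈ Finset.range ⌈τ⌉₊, alg.runLaw (G v) T (D T v) := by
    intro v
    obtain ⟨T, hT, hTτ⟩ := hbad v
    calc _ ≤ alg.runLaw (G v) T (D T v) := hT.trans (measure_mono (hsucc T v))
      _ ≤ _ := Finset.single_le_sum (f := fun T => alg.runLaw (G v) T (D T v))
          (fun _ _ => zero_le) (Finset.mem_range.2 (Nat.lt_ceil.2 hTτ))
  have htotal : 2 ^ C.card * ENNReal.ofReal (1 - δ) ≤ 2 ^ C.card *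
      (⌈τ⌉₊ * ENNReal.ofReal (Real.exp (-(b * C.card / 2)))) := by
    calc 2 ^ C.card * ENNReal.ofReal (1 - δ) = ∑ _v : C → Bool, ENNReal.ofReal (1 - δ) := by
          simp
      _ ≤ ∑ v, ∑ T ∈ Finset.range ⌈τ⌉₊, alg.runLaw (G v) T (D T v) :=
          Finset.sum_le_sum fun v _ => hlow v
      _ = ∑ T ∈ Finset.range ⌈τ⌉₊, ∑ v, alg.runLaw (G v) T (D T v) := Finset.sum_comm
      _ ≤ ∑ _T ∈ Finset.range ⌈τ⌉₊,
          2 ^ C.card * ENNReal.ofReal (Real.exp (-(b * C.card / 2))) := Finset.sum_le_sum hup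
      _ = _ := by rw [Finset.sum_const, Finset.card_range, nsmul_eq_mul]; ring
  rw [ENNReal.mul_le_mul_iff_right (by positivity) (by finiteness), ← ENNReal.ofReal_natCast,
    ← ENNReal.ofReal_mul (by positivity), ENNReal.ofReal_le_ofReal_iff (by positivity)] at htotal
  have : (⌈τ⌉₊ : ℝ) * Real.exp (-(b * C.card / 2)) ≤ (τ + 1) * Real.exp (-(b * C.card / 2)) := by
    have := (Nat.ceil_lt_add_one hτ).le
    gcongr
  linarith

/-! ### Choice of the parameters for small `ε` -/

theorem exists_forall_inv_of_eventually_atTop {p : ℝ → Prop} (h : ∀ᶠ y in Filter.atTop, p y) :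
    ∃ ε₀ : ℝ, 0 < ε₀ ∧ ∀ ε ∈ Set.Ioo (0 : ℝ) ε₀, p ε⁻¹ := by
  obtain ⟨ε₀, hε₀, h'⟩ := mem_nhdsGT_iff_exists_Ioo_subset.1
    (tendsto_inv_nhdsGT_zero.eventually h)
  exact ⟨ε₀, hε₀, fun ε hε => h' hε⟩

theorem tendsto_polynomial_mul_exp_neg_sqrt (a : ℝ) {k : ℝ} (hk : 0 < k) (n : ℕ) :
    Filter.Tendsto (fun y => (a * y ^ n + 1) * Real.exp (-(k * √y))) Filter.atTop (nhds 0) := by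
  have h : ∀ m : ℕ, Filter.Tendsto (fun u : ℝ => u ^ m * Real.exp (-(k * u)))
      Filter.atTop (nhds 0) := fun m => by
    have h1 := Real.tendsto_pow_mul_exp_neg_atTop_nhds_zero m
    have h2 := (h1.comp (Filter.tendsto_id.const_mul_atTop hk)).const_mul (k ^ m)⁻¹
    rw [mul_zero] at h2
    refine h2.congr fun u => ?_
    simp only [Function.comp_apply, id_eq, mul_pow]
    field_simp
  have h3 := (((h (2 * n)).const_mul a).add (h 0)).comp Real.tendsto_sqrt_atTop
  rw [mul_zero, add_zero] at h3
  refine h3.congr' ?_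
  filter_upwards [Filter.eventually_ge_atTop 0] with y hy
  simp only [Function.comp_apply, pow_mul, Real.sq_sqrt hy]
  ring

/-- The numerical conditions of `exists_hard_game` for `b = 1 / √N`, when `y = 1 / ε` is large and
there are `N ≥ c yᵈ` points. -/
theorem hard_game_conditions {c y N δ : ℝ} {d : ℕ} (hd : 1 ≤ d) (hc : 0 < c) (hN : c * y ^ d ≤ N)
    (hy : 4 ≤ y) (hlog : 2 ≤ Real.log y) (hcy : 256 ≤ c ^ 2 * y)
    (hexp : (c / 128 * d * y ^ (d + 3) + 1) * Real.exp (-(√c / 2 * √y)) < 1 - δ) :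
    4 * (√N)⁻¹ < 1 ∧ 2 * ((√N)⁻¹ / Real.log (1 / (4 * (√N)⁻¹))) ≤ 1 ∧
    16 * ((√N)⁻¹ / Real.log (1 / (4 * (√N)⁻¹))) * y⁻¹ ^ 2 *
      (c / 128 * d * y ^ (d + 2) * Real.log y) ≤ (√N)⁻¹ * N / 2 ∧
    (c / 128 * d * y ^ (d + 2) * Real.log y + 1) * Real.exp (-((√N)⁻¹ * N / 2)) < 1 - δ := by
  have hy0 : 0 < y := by linarith
  have hy1 : 1 ≤ y := by linarith
  have hyd : y ≤ y ^ d := le_self_pow₀ hy1 (by omega)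
  have hd1 : (1 : ℝ) ≤ d := by exact_mod_cast hd
  have hN0 : 0 < N := lt_of_lt_of_le (by positivity) hN
  have hs : 0 < √N := Real.sqrt_pos.2 hN0
  have hsN : √N * √N = N := Real.mul_self_sqrt hN0.le
  -- The spare factor `y ≤ y ^ d` in `(c y^d)²` absorbs `c` and `256`, so that `log (√N / 4)` is at
  -- least `(d / 4) log y` with no constant depending on `d` or `c`.
  have hsq : y ^ d ≤ (N / 16) ^ 2 := by
    have h1 : (c * y ^ d) ^ 2 ≤ N ^ 2 := by gcongr
    have h2 : 256 * y ^ d ≤ c ^ 2 * y * y ^ d := by gcongr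
    have h3 : c ^ 2 * y * y ^ d ≤ c ^ 2 * y ^ d * y ^ d := by gcongr
    nlinarith
  have h16 : 1 < N / 16 := by nlinarith
  have hs4 : 4 < √N := by
    rw [Real.lt_sqrt (by norm_num)]; linarith
  have hinv : 1 / (4 * (√N)⁻¹) = √N / 4 := by field_simp
  have hlogN : d * Real.log y ≤ 4 * Real.log (√N / 4) := by
    have h1 : (√N / 4) ^ 4 = (N / 16) ^ 2 := by
      calc (√N / 4) ^ 4 = (√N * √N / 16) ^ 2 := by ring
        _ = _ := by rw [hsN]
    calc d * Real.log y = Real.log (y ^ d) := by rw [Real.log_pow]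
      _ ≤ Real.log ((√N / 4) ^ 4) := by
          rw [h1]; exact Real.log_le_log (by positivity) hsq
      _ = _ := by rw [Real.log_pow]; norm_num
  have hL : 1 / 2 ≤ Real.log (√N / 4) := by nlinarith
  have hL0 : 0 < Real.log (√N / 4) := by linarith
  have hi4 : 4 * (√N)⁻¹ < 1 := by
    rw [mul_inv_lt_iff₀ hs]; linarith
  have hmul : (√N)⁻¹ * N = √N := by
    rw [inv_mul_eq_iff_eq_mul₀ hs.ne', hsN]
  have hle : c / 128 * d * y ^ (d + 2) * Real.log y ≤ c / 128 * d * y ^ (d + 3) := by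
    have h1 : Real.log y ≤ y := Real.log_le_self hy0.le
    calc _ ≤ c / 128 * d * y ^ (d + 2) * y := by gcongr
      _ = _ := by ring
  rw [hinv]
  refine ⟨hi4, ?_, ?_, ?_⟩
  · rw [← mul_div_assoc, div_le_one hL0]; linarith
  · have h1 : (√N)⁻¹ / Real.log (√N / 4) * (d * Real.log y) ≤ (√N)⁻¹ * 4 := by
      rw [div_mul_eq_mul_div, div_le_iff₀ hL0, mul_assoc]
      gcongr
    -- The constant `1 / 128` is fixed here: `16 / 128 = 1 / 8`, and the logarithms contribute `4`,
    -- which gives the required `1 / 2`.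
    calc _ = (c * y ^ d) * ((√N)⁻¹ / Real.log (√N / 4) * (d * Real.log y)) / 8 := by
          field_simp; ring
      _ ≤ N * ((√N)⁻¹ * 4) / 8 := by gcongr
      _ = _ := by ring
  · refine lt_of_le_of_lt ?_ hexp
    rw [hmul]
    have h1 : √c * √y ≤ √N := by
      rw [← Real.sqrt_mul hc.le]
      exact Real.sqrt_le_sqrt (le_trans (by gcongr) hN)
    have h2 : -(√N / 2) ≤ -(√c / 2 * √y) := by linarith
    gcongr

end MarkovGame

theorem theorem2 :
    ∃ C' : ℝ, 0 < C' ∧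
    ∀ d : ℕ, 1 ≤ d →
    ∀ δ ∈ Set.Ioo (0 : ℝ) 1,
    ∃ ε₀ : ℝ, 0 < ε₀ ∧
    -- the action set, the states of player 1 and the transitions are arbitrary
    ∀ (A : Type*) [Finite A] [Nonempty A] [MeasurableSpace A] [MeasurableSingletonClass A]
      (S₁ : Set (MarkovGame.cube d)) (_ : MeasurableSet S₁)
      (step : MarkovGame.cube d × A → MarkovGame.cube d) (_ : Measurable step)
      (alg : MarkovGame.Algorithm (MarkovGame.cube d) A),
    ∀ ε ∈ Set.Ioo (0 : ℝ) ε₀,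
    ∃ (g : MarkovGame.Game (MarkovGame.cube d) A) (f : MarkovGame.cube d → unitInterval)
      (V : MarkovGame.cube d → ℝ),
      g.S₁ = S₁ ∧ g.step = step ∧ g.γ = 0 ∧
      -- rewards are Bernoulli with a 1-Lipschitz mean that does not depend on the action
      LipschitzWith 1 f ∧
      (∀ x a, g.reward (x, a) = ProbabilityTheory.bernoulliMeasure (1 : ℝ) 0 (f x)) ∧
      g.IsOptimalValue V ∧
      ∀ T : ℕ,
        ENNReal.ofReal (1 - δ) ≤ alg.runLaw g T (alg.success T V ε) →
        C' * d * (ε⁻¹) ^ (d + 2) * Real.log ε⁻¹ ≤ T := by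
  obtain ⟨c, hc, hpack⟩ := MarkovGame.exists_separated_points
  refine ⟨c / 128, by positivity, fun d hd δ hδ => ?_⟩
  have hlim := MarkovGame.tendsto_polynomial_mul_exp_neg_sqrt (c / 128 * d)
    (half_pos (Real.sqrt_pos.2 hc)) (d + 3)
  obtain ⟨ε₀, hε₀, hlarge⟩ := MarkovGame.exists_forall_inv_of_eventually_atTop
    -- Only these thresholds depend on `d` and `δ`; the constant `c / 128` does not.
    ((Filter.eventually_ge_atTop 4).and ((Real.tendsto_log_atTop.eventually_ge_atTop 2).and
      (((Filter.tendsto_id.const_mul_atTop (pow_pos hc 2)).eventually_ge_atTop 256).and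
        (hlim.eventually_lt_const (sub_pos.2 hδ.2)))))
  refine ⟨ε₀, hε₀, ?_⟩
  intro A _ _ _ _ S₁ hS₁ step hstep alg ε hε
  obtain ⟨hy, hlog, hcy, hexp⟩ := hlarge ε hε
  obtain ⟨C, hcard, hsep⟩ := hpack d hd ε hε.1
  have hinv : 0 < ε⁻¹ := inv_pos.2 hε.1
  have hε' : ε ≤ 1 / 4 := by
    rw [← inv_inv ε, ← one_div]
    exact one_div_le_one_div_of_le (by norm_num) hy
  obtain ⟨h1, h2, h3, h4⟩ := MarkovGame.hard_game_conditions hd hc hcard hy hlog hcy hexp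
  rw [inv_inv] at h3
  have hN : (0 : ℝ) < C.card := lt_of_lt_of_le (by positivity) hcard
  exact MarkovGame.exists_hard_game (MarkovGame.isCompact_cube d) hS₁ hstep alg hε.1 hε' hsep
    (inv_pos.2 (Real.sqrt_pos.2 hN)) h1 h2
    (mul_nonneg (by positivity) (by linarith)) h3 h4
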